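/- Graphs are finite and undirected. A graph is called series-parallel if it has no $K_4$ minor. In the $k$-cops and robber game on a graph $G$ ($k\ge 1$), $k$ cops choose (not necessarily distinct) initial vertices, and then the robber chooses his. Afterwards, starting with the cops, the cops and the robber move alternately, where in a move every cop (respectively the robber) either stays where he is or slides along an edge; all players have complete information. The cops win as soon as a cop and the robber are on the same vertex; the robber wins if this never happens. $G$ is $k$-copwin if the cops have a winning strategy, and the cop number of $G$ is the smallest $k\ge 1$ such that $G$ is $k$-copwin. For $X\subseteq V(G)$ with $|X|\le k$, the $k$-cops and robber game on $G$ with set of exits $X$ differs in the following: initially, one cop is placed on each vertex of $X$, and the robber places the remaining $k-|X|$ cops and himself on arbitrary vertices; the robber also wins if, after a move of the cops, he stands on a vertex of $X$ on which there is no cop. $G$ is $X$-exit $k$-copwin if the cops have a winning strategy in this game. **Theorem.** Every connected series-parallel graph is $\{x\}$-exit $2$-copwin for each of its vertices $x$. Consequently, every connected series-parallel graph is $2$-copwin, that is, its cop number is at most $2$. -/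

import Mathlib

namespace CopsRobber

/-- `H` is a minor of `G`: there are pairwise disjoint connected (in particular non-empty) branch
sets in `G`, one for each vertex of `H`, such that `G` has an edge between the branch sets of any
two adjacent vertices of `H`. -/
def IsMinor {W V : Type*} (H : SimpleGraph W) (G : SimpleGraph V) : Prop :=
  ∃ B : W → Set V,
    (∀ w, (G.induce (B w)).Connected) ∧
    (∀ w w', w ≠ w' → Disjoint (B w) (B w')) ∧
    (∀ w w', H.Adj w w' → ∃ a ∈ B w, ∃ b ∈ B w', G.Adj a b)

/-- A graph is series-parallel if it has no `K₄` minor. -/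
def IsSeriesParallel {V : Type*} (G : SimpleGraph V) : Prop :=
  ¬ IsMinor (SimpleGraph.completeGraph (Fin 4)) G

/-- A single player (a cop, or the robber) passes or slides along an edge. -/
def Step {V : Type*} (G : SimpleGraph V) (a b : V) : Prop :=
  a = b ∨ G.Adj a b

/-- The positions of `k` cops and of the robber. -/
structure Position (V : Type*) (k : ℕ) where
  /-- the vertices occupied by the cops -/
  cops : Fin k → V
  /-- the vertex occupied by the robber -/
  robber : V

/-- A strategy of `k` cops. Given the list of the positions at the beginning of all earlier rounds
(oldest first), and the position at the beginning of the current round, it tells every cop where to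
move; each cop passes or moves along an edge. -/
structure Strategy {V : Type*} (G : SimpleGraph V) (k : ℕ) where
  /-- the new vertices of the cops -/
  move : List (Position V k) → Position V k → Fin k → V
  /-- the moves follow the rules of the game -/
  legal : ∀ past p i, Step G (p.cops i) (move past p i)

/-- The sequence `p` is a play in which the cops follow the strategy `σ`. Here `p t` is the position
at the beginning of round `t`, before the move of the cops; in round `t`, first all cops move
from `(p t).cops` to `(p (t + 1)).cops`, and then the robber moves from `(p t).robber` to
`(p (t + 1)).robber`. (Plays are continued formally after the game has ended.) -/
def IsPlay {V : Type*} {G : SimpleGraph V} {k : ℕ} (σ : Strategy G k)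
    (p : ℕ → Position V k) : Prop :=
  ∀ t, (p (t + 1)).cops = σ.move ((List.range t).map p) (p t) ∧
    Step G (p t).robber (p (t + 1)).robber

/-- The robber is caught in round `t`: a cop is on the vertex of the robber at the beginning of
the round, or after the move of the cops in that round. -/
def CaughtAt {V : Type*} {k : ℕ} (p : ℕ → Position V k) (t : ℕ) : Prop :=
  (∃ i, (p t).cops i = (p t).robber) ∨ (∃ i, (p (t + 1)).cops i = (p t).robber)

/-- The robber stands alone on an exit vertex after the move of the cops in round `t`. -/
def EscapesAt {V : Type*} {k : ℕ} (X : Finset V) (p : ℕ → Position V k) (t : ℕ) : Prop :=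
  (p t).robber ∈ X ∧ ∀ i, (p (t + 1)).cops i ≠ (p t).robber

/-- The cops win the play `p` with set of exits `X`: the robber is caught at some time, and has
not left through an exit before. -/
def CopsWin {V : Type*} {k : ℕ} (X : Finset V) (p : ℕ → Position V k) : Prop :=
  ∃ t, CaughtAt p t ∧ ∀ s < t, ¬ EscapesAt X p s

/-- `G` is `k`-copwin: the cops can choose initial vertices and a strategy which wins whatever
the robber does (including the choice of his initial vertex). -/
def Copwin {V : Type*} (G : SimpleGraph V) (k : ℕ) : Prop :=
  ∃ (c₀ : Fin k → V) (σ : Strategy G k), ∀ p : ℕ → Position V k,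
    (p 0).cops = c₀ → IsPlay σ p → CopsWin ∅ p

/-- `G` is `X`-exit `k`-copwin, where `#X ≤ k`: the cops have a strategy which wins from every
initial position in which every exit is occupied by a cop (the other cops and the robber are
placed by the robber), whatever the robber does. -/
def ExitCopwin {V : Type*} (G : SimpleGraph V) (X : Finset V) (k : ℕ) : Prop :=
  X.card ≤ k ∧ ∃ σ : Strategy G k, ∀ p : ℕ → Position V k,
    (∀ x ∈ X, ∃ i, (p 0).cops i = x) → IsPlay σ p → CopsWin X p

/-- The cop number of `G`, the smallest integer `k ≥ 1` such that `G` is `k`-copwin. -/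
noncomputable def copNumber {V : Type*} (G : SimpleGraph V) : ℕ :=
  sInf {k : ℕ | 1 ≤ k ∧ Copwin G k}

end CopsRobber

/-! One cop keeps the robber confined to a connected, exit-free territory C with at most two outer
neighbours a and b, by staying within a step of the robber's image under a map fixing a and b.
Meanwhile the other cop takes up a geodesic from a to b through C, onto which distance from a gives
a nonexpansive retraction; once he is next to the robber's shadow there, he guards the whole path.
The robber's component C' of C minus the path has at most two neighbours on it: three of them,
together with a connection from a to b outside C, would give a K₄ minor
(`IsShadowPath.attachments`). So C' is a smaller territory guarded by the second cop; the cops swap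
roles and induct on |C| (`IsTerritory.wins`). The start is a cop on x, guarding the robber's
component of G - x with a = b = x. -/

namespace CopsRobber

/-! ### Winning positions and positional strategies -/

section Game

variable {V : Type*} {G : SimpleGraph V} {k : ℕ} {X : Finset V}

/-- With the cops on `c`, the robber on `r` and the cops to move, the cops can win the game with
exits `X` within `n` rounds. -/
def WinsWithin (G : SimpleGraph V) (X : Finset V) : ℕ → (Fin k → V) → V → Prop
  | 0, c, r => ∃ i, c i = r
  | n + 1, c, r => WinsWithin G X n c r ∨ ∃ c' : Fin k → V, (∀ i, Step G (c i) (c' i)) ∧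
      ((∃ i, c' i = r) ∨ (r ∉ X ∧ ∀ r', Step G r r' → WinsWithin G X n c' r'))

/-- With the cops on `c`, the robber on `r` and the cops to move, the cops can win the game with
exits `X`. -/
def Wins (G : SimpleGraph V) (X : Finset V) (c : Fin k → V) (r : V) : Prop :=
  ∃ n, WinsWithin G X n c r

theorem WinsWithin.mono {m n : ℕ} (h : m ≤ n) {c : Fin k → V} {r : V}
    (hw : WinsWithin G X m c r) : WinsWithin G X n c r := by
  induction h with
  | refl => exact hw
  | step _ ih => exact Or.inl ih

theorem Wins.of_catch {c : Fin k → V} {r : V} (i : Fin k) (h : Step G (c i) r) :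
    Wins G X c r := by
  classical
  refine ⟨1, Or.inr ⟨Function.update c i r, fun l => ?_, Or.inl ⟨i, by simp⟩⟩⟩
  by_cases hl : l = i
  · subst hl; simpa using h
  · simp [hl, Step]

theorem Wins.of_move [Finite V] {c c' : Fin k → V} {r : V} (hc : ∀ i, Step G (c i) (c' i))
    (hr : r ∉ X) (h : ∀ r', Step G r r' → Wins G X c' r') : Wins G X c r := by
  -- Finiteness of `V` bounds the number of rounds needed over all replies of the robber.
  have : ∀ r', ∃ n, Step G r r' → WinsWithin G X n c' r' := by
    intro r'
    by_cases hs : Step G r r'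
    · obtain ⟨n, hn⟩ := h r' hs
      exact ⟨n, fun _ => hn⟩
    · exact ⟨0, fun h => absurd h hs⟩
  choose N hN using this
  obtain ⟨M, hM⟩ := (Set.finite_range N).bddAbove
  exact ⟨M + 1, Or.inr ⟨c', hc, Or.inr ⟨hr, fun r' hs => (hN r' hs).mono (hM ⟨r', rfl⟩)⟩⟩⟩

/-- At most one `n` meets both conditions (the position's rank is `n + 1`), so one move depending
only on the position serves for all `n`. -/
theorem exists_good_move (G : SimpleGraph V) (X : Finset V) (c : Fin k → V) (r : V) :
    ∃ c' : Fin k → V, (∀ i, Step G (c i) (c' i)) ∧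
      ∀ n, WinsWithin G X (n + 1) c r → ¬ WinsWithin G X n c r →
        (∃ i, c' i = r) ∨ (r ∉ X ∧ ∀ r', Step G r r' → WinsWithin G X n c' r') := by
  by_cases h : ∃ n, WinsWithin G X (n + 1) c r ∧ ¬ WinsWithin G X n c r
  · obtain ⟨n, hn, hn'⟩ := h
    obtain ⟨c', hc, hc'⟩ := hn.resolve_left hn'
    refine ⟨c', hc, fun m hm hm' => ?_⟩
    have hmn : m = n := by
      by_contra hne
      rcases lt_or_gt_of_ne hne with hlt | hlt
      · exact hn' (hm.mono hlt)
      · exact hm' (hn.mono hlt)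
    exact hmn ▸ hc'
  · exact ⟨c, fun _ => Or.inl rfl, fun n hn hn' => absurd ⟨n, hn, hn'⟩ h⟩

/-- A single strategy wins from all positions from which the cops can win. -/
theorem exists_strategy_copsWin (G : SimpleGraph V) (X : Finset V) (k : ℕ) :
    ∃ σ : Strategy G k, ∀ p : ℕ → Position V k, Wins G X (p 0).cops (p 0).robber →
      IsPlay σ p → CopsWin X p := by
  choose mv legal good using exists_good_move (k := k) G X
  refine ⟨⟨fun _ q => mv q.cops q.robber, fun _ q i => legal _ _ i⟩, ?_⟩
  rintro p ⟨n, hn⟩ hp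
  have key : ∀ n t, WinsWithin G X n (p t).cops (p t).robber →
      ∃ t', t ≤ t' ∧ CaughtAt p t' ∧ ∀ s, t ≤ s → s < t' → ¬ EscapesAt X p s := by
    intro n
    induction n with
    | zero => exact fun t h => ⟨t, le_rfl, Or.inl h, fun s h1 h2 => by omega⟩
    | succ n ih =>
      intro t h
      by_cases h' : WinsWithin G X n (p t).cops (p t).robber
      · exact ih t h'
      have hm : (p (t + 1)).cops = mv (p t).cops (p t).robber := (hp t).1
      rcases good _ _ n h h' with hc | ⟨hX, hc⟩
      · exact ⟨t, le_rfl, Or.inr (hm ▸ hc), fun s h1 h2 => by omega⟩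
      · obtain ⟨t', ht', hcaught, hesc⟩ := ih (t + 1) (hm ▸ hc _ (hp t).2)
        refine ⟨t', by omega, hcaught, fun s h1 h2 => ?_⟩
        rcases h1.eq_or_lt with rfl | h1
        · exact fun he => hX he.1
        · exact hesc s h1 h2
  obtain ⟨t, -, ht, hs⟩ := key n 0 hn
  exact ⟨t, ht, fun s h => hs s (Nat.zero_le s) h⟩

end Game

/-! ### Components, path segments and K₄ minors -/

section Connectivity

variable {V : Type*} {G : SimpleGraph V}

/-- The vertices which can be reached from `r` by a walk inside `S`. -/
def reachableWithin (G : SimpleGraph V) (S : Set V) (r : V) : Set V :=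
  {v | ∃ w : G.Walk r v, ∀ z ∈ w.support, z ∈ S}

theorem reachableWithin_subset (S : Set V) (r : V) : reachableWithin G S r ⊆ S :=
  fun _ ⟨w, hw⟩ => hw _ w.end_mem_support

theorem mem_reachableWithin_self {S : Set V} {r : V} (hr : r ∈ S) : r ∈ reachableWithin G S r :=
  ⟨.nil, by simpa using hr⟩

theorem mem_reachableWithin_of_adj {S : Set V} {r u v : V} (hu : u ∈ reachableWithin G S r)
    (h : G.Adj u v) (hv : v ∈ S) : v ∈ reachableWithin G S r := by
  obtain ⟨w, hw⟩ := hu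
  refine ⟨w.concat h, fun z hz => ?_⟩
  rw [SimpleGraph.Walk.support_concat, List.mem_append] at hz
  rcases hz with hz | hz
  · exact hw z hz
  · rw [List.mem_singleton.1 hz]; exact hv

theorem connected_reachableWithin {S : Set V} {r : V} (hr : r ∈ S) :
    (G.induce (reachableWithin G S r)).Connected := by
  classical
  refine G.induce_connected_of_patches r (mem_reachableWithin_self hr) ?_
  rintro v ⟨w, hw⟩
  refine ⟨{z | z ∈ w.support}, fun z hz => ⟨w.takeUntil z hz, fun y hy =>
    hw y (w.support_takeUntil_subset_support hz hy)⟩, w.start_mem_support, w.end_mem_support, ?_⟩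
  exact w.connected_induce_support _ _

theorem exists_adj_reachableWithin (hG : G.Connected) {S : Set V} {r y : V} (hr : r ∈ S)
    (hy : y ∉ S) : ∃ u ∈ reachableWithin G S r, ∃ v ∉ S, G.Adj u v := by
  obtain ⟨w⟩ := hG r y
  obtain ⟨d, -, h1, h2⟩ := w.exists_boundary_dart (reachableWithin G S r)
    (mem_reachableWithin_self hr) (fun h => hy (reachableWithin_subset _ _ h))
  exact ⟨d.fst, h1, d.snd, fun h => h2 (mem_reachableWithin_of_adj h1 d.adj h), d.adj⟩

theorem connected_induce_image_Icc {p : ℕ → V} {i j : ℕ} (hij : i ≤ j)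
    (h : ∀ l, i ≤ l → l < j → G.Adj (p l) (p (l + 1))) :
    (G.induce (p '' Set.Icc i j)).Connected := by
  induction j, hij using Nat.le_induction with
  | base =>
    rw [Set.Icc_self, Set.image_singleton]
    exact SimpleGraph.connected_iff _ |>.2 ⟨SimpleGraph.Preconnected.of_subsingleton, ⟨p i, rfl⟩⟩
  | succ j hij ih =>
    have heq : p '' Set.Icc i (j + 1) = p '' Set.Icc i j ∪ {p j, p (j + 1)} := by
      rw [← Set.image_pair, ← Set.image_union]
      congr 1
      ext l
      simp only [Set.mem_Icc, Set.mem_union, Set.mem_insert_iff, Set.mem_singleton_iff]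
      omega
    rw [heq]
    exact SimpleGraph.induce_union_connected
      (ih fun l h1 h2 => h l h1 (by omega)).preconnected
      (SimpleGraph.induce_pair_connected_of_adj (h j hij (by omega))).preconnected
      ⟨p j, ⟨j, ⟨hij, le_rfl⟩, rfl⟩, Or.inl rfl⟩

theorem isMinor_completeGraph_four {A B C D : Set V}
    (hA : (G.induce A).Connected) (hB : (G.induce B).Connected)
    (hC : (G.induce C).Connected) (hD : (G.induce D).Connected)
    (dAB : Disjoint A B) (dAC : Disjoint A C) (dAD : Disjoint A D)
    (dBC : Disjoint B C) (dBD : Disjoint B D) (dCD : Disjoint C D)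
    (eAB : ∃ a ∈ A, ∃ b ∈ B, G.Adj a b) (eAC : ∃ a ∈ A, ∃ b ∈ C, G.Adj a b)
    (eAD : ∃ a ∈ A, ∃ b ∈ D, G.Adj a b) (eBC : ∃ a ∈ B, ∃ b ∈ C, G.Adj a b)
    (eBD : ∃ a ∈ B, ∃ b ∈ D, G.Adj a b) (eCD : ∃ a ∈ C, ∃ b ∈ D, G.Adj a b) :
    IsMinor (SimpleGraph.completeGraph (Fin 4)) G := by
  have symm : ∀ {S T : Set V}, (∃ a ∈ S, ∃ b ∈ T, G.Adj a b) → ∃ a ∈ T, ∃ b ∈ S, G.Adj a b :=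
    fun ⟨a, ha, b, hb, h⟩ => ⟨b, hb, a, ha, h.symm⟩
  refine ⟨![A, B, C, D], ?_, ?_, ?_⟩
  · intro w
    fin_cases w <;> assumption
  · intro w w' hne
    fin_cases w <;> fin_cases w' <;>
      first | exact absurd rfl hne | assumption | (apply Disjoint.symm; assumption)
  · intro w w' hne
    fin_cases w <;> fin_cases w' <;>
      first | exact absurd rfl hne.ne | assumption | (apply symm; assumption)

end Connectivity

/-! ### Guarded territories and shadow paths -/

section Territory

variable {V : Type*} {G : SimpleGraph V} {X : Finset V} {C : Set V} {a b : V}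

/-- `a` and `b` are joined by a connected subgraph which avoids `C`; moreover `b` is attached to
the connected set `O` containing `a`. -/
def LinkedOutside (G : SimpleGraph V) (C : Set V) (a b : V) : Prop :=
  ∃ O : Set V, (G.induce O).Connected ∧ a ∈ O ∧ b ∉ O ∧ Disjoint O C ∧ ∃ o ∈ O, G.Adj o b

/-- A connected set of vertices without exits, whose only outer neighbours are `a` and `b`. -/
structure IsTerritory (G : SimpleGraph V) (X : Finset V) (C : Set V) (a b : V) : Prop where
  conn : (G.induce C).Connected
  notMem_exits : ∀ r ∈ C, r ∉ X
  left_notMem : a ∉ C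
  right_notMem : b ∉ C
  left_adj : ∃ u ∈ C, G.Adj a u
  right_adj : ∃ u ∈ C, G.Adj b u
  boundary : ∀ u ∈ C, ∀ v, G.Adj u v → v ∈ C ∨ v = a ∨ v = b
  linked : a = b ∨ LinkedOutside G C a b

/-- A map such that a cop on the image of a robber in `C` can stay on his image, and so guards
`a` and `b`. -/
structure IsGuardMap (G : SimpleGraph V) (C : Set V) (a b : V) (g : V → V) : Prop where
  left : g a = a
  right : g b = b
  step : ∀ u ∈ C, ∀ v, G.Adj u v → Step G (g u) (g v)

/-- A path `p 0, …, p L` in `G` together with a retraction `p ∘ f` onto it, which is nonexpansive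
on the edges that meet `C`. -/
structure IsShadowPath (G : SimpleGraph V) (C : Set V) (a b : V) (p : ℕ → V) (L : ℕ)
    (f : V → ℕ) : Prop where
  le : ∀ v, f v ≤ L
  adj : ∀ i < L, G.Adj (p i) (p (i + 1))
  apply_path : ∀ i ≤ L, f (p i) = i
  lipschitz : ∀ u ∈ C, ∀ v, G.Adj u v → f v ≤ f u + 1 ∧ f u ≤ f v + 1
  inner : ∀ i, 0 < i → i < L → p i ∈ C
  meets : ∃ i ≤ L, p i ∈ C
  left : ∃ i ≤ L, p i = a
  right : ∃ i ≤ L, p i = b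
  linked : L ≤ 1 ∨ LinkedOutside G C (p 0) (p L)

theorem IsGuardMap.step_step {g : V → V} (hg : IsGuardMap G C a b g) {u v : V} (hu : u ∈ C)
    (h : Step G u v) : Step G (g u) (g v) := by
  rcases h with rfl | h
  · exact Or.inl rfl
  · exact hg.step u hu v h

/-- Since `g` fixes `a` and `b`, a robber who steps there stands on his own image and is within the
guard's reach. -/
theorem IsGuardMap.wins {g : V → V} (hg : IsGuardMap G C a b g) {k : ℕ} {c : Fin k → V} {r : V}
    {i : Fin k} (hi : Step G (c i) (g r)) (hr : r = a ∨ r = b) : Wins G X c r := by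
  refine Wins.of_catch i ?_
  rcases hr with rfl | rfl
  · rwa [hg.left] at hi
  · rwa [hg.right] at hi

/-- One round in which cop `i` guards the territory and cop `j` moves to `t`. -/
theorem IsTerritory.wins_of_round [Finite V] (hT : IsTerritory G X C a b) {g : V → V}
    (hg : IsGuardMap G C a b g) {i j : Fin 2} (hij : i ≠ j) {c : Fin 2 → V} {r t : V}
    (hr : r ∈ C) (hi : Step G (c i) (g r)) (hj : Step G (c j) t)
    (next : ∀ r' ∈ C, Step G r r' → ∀ c' : Fin 2 → V, Step G (c' i) (g r') → c' j = t →
      Wins G X c' r') : Wins G X c r := by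
  have hcases : ∀ l, l = i ∨ l = j := by omega
  refine Wins.of_move (c' := fun l => if l = i then g r else t) (fun l => ?_)
    (hT.notMem_exits r hr) (fun r' hs => ?_)
  · rcases hcases l with rfl | rfl
    · simpa using hi
    · simpa [hij.symm] using hj
  · have hi' : Step G ((fun l => if l = i then g r else t) i) (g r') := by
      simpa using hg.step_step hr hs
    have hr' : r' ∈ C ∨ r' = a ∨ r' = b := by
      rcases hs with rfl | hs
      · exact Or.inl hr
      · exact hT.boundary r hr r' hs
    rcases hr' with hr' | hr'
    · exact next r' hr' hs _ hi' (by simp [hij.symm])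
    · exact hg.wins hi' hr'

/-- While cop `i` guards the territory, the other cop can go wherever he wants. -/
theorem IsTerritory.wins_of_reposition [Finite V] (hG : G.Connected)
    (hT : IsTerritory G X C a b) {g : V → V} (hg : IsGuardMap G C a b g) {i j : Fin 2}
    (hij : i ≠ j) (t : V)
    (next : ∀ c : Fin 2 → V, ∀ r ∈ C, Step G (c i) (g r) → c j = t → Wins G X c r)
    {c : Fin 2 → V} {r : V} (hr : r ∈ C) (hi : Step G (c i) (g r)) : Wins G X c r := by
  obtain ⟨w⟩ := hG (c j) t
  generalize hs : c j = s at w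
  induction w generalizing c r with
  | nil => exact next c r hr hi hs
  | cons h w ih =>
    exact hT.wins_of_round hg hij hr hi (Or.inr (hs ▸ h))
      fun r' hr' _ c' hi' hj' => ih next hr' hi' hj'

/-- While cop `i` guards the territory, the other cop can catch the shadow of the robber. -/
theorem IsTerritory.wins_of_track [Finite V] (hT : IsTerritory G X C a b) {g : V → V}
    (hg : IsGuardMap G C a b g) {p : ℕ → V} {L : ℕ} {f : V → ℕ}
    (hp : IsShadowPath G C a b p L f) {i j : Fin 2} (hij : i ≠ j)
    (next : ∀ c : Fin 2 → V, ∀ r ∈ C, Step G (c j) (p (f r)) → Wins G X c r)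
    {c : Fin 2 → V} {r : V} (hr : r ∈ C) (hi : Step G (c i) (g r)) {m : ℕ} (hm : m ≤ f r)
    (hj : c j = p m) : Wins G X c r := by
  induction hd : L - m generalizing c r m with
  | zero =>
    have := hp.le r
    exact next c r hr (Or.inl (by rw [hj]; congr 1; omega))
  | succ d ih =>
    rcases hm.eq_or_lt with rfl | hm
    · exact next c r hr (Or.inl hj)
    · refine hT.wins_of_round hg hij hr hi (Or.inr (hj ▸ hp.adj m (by omega)))
        fun r' hr' hs c' hi' hj' => ?_
      have hf : f r ≤ f r' + 1 := by
        rcases hs with rfl | hs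
        · omega
        · exact (hp.lipschitz r hr r' hs).2
      -- The shadow moves by at most one, so it can only swap places with the cop, and then it is
      -- adjacent to him.
      by_cases hlt : m + 1 ≤ f r'
      · exact ih hr' hi' hlt hj' (by omega)
      · have hfm : f r' = m := by omega
        refine next c' r' hr' (Or.inr ?_)
        rw [hj', hfm]
        exact (hp.adj m (by omega)).symm

variable {p : ℕ → V} {L : ℕ} {f : V → ℕ}

theorem IsShadowPath.inj (hp : IsShadowPath G C a b p L f) {i j : ℕ} (hi : i ≤ L) (hj : j ≤ L)
    (h : p i = p j) : i = j := by
  rw [← hp.apply_path i hi, h, hp.apply_path j hj]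

theorem IsShadowPath.isGuardMap (hp : IsShadowPath G C a b p L f) {C' : Set V} (hC : C' ⊆ C)
    {i j : ℕ} (hi : i ≤ L) (hj : j ≤ L) : IsGuardMap G C' (p i) (p j) (fun v => p (f v)) := by
  refine ⟨by simp only [hp.apply_path i hi], by simp only [hp.apply_path j hj], ?_⟩
  intro u hu v huv
  obtain ⟨h1, h2⟩ := hp.lipschitz u (hC hu) v huv
  have hu := hp.le u
  have hv := hp.le v
  rcases lt_trichotomy (f u) (f v) with h | h | h
  · rw [show f v = f u + 1 by omega]
    exact Or.inr (hp.adj _ (by omega))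
  · exact Or.inl (by simp only [h])
  · rw [show f u = f v + 1 by omega]
    exact Or.inr (hp.adj _ (by omega)).symm

/-- In a series-parallel graph, a connected part of the territory off the path is attached to at
most two vertices of the path. -/
theorem IsShadowPath.attachments (hsp : IsSeriesParallel G) (hp : IsShadowPath G C a b p L f)
    {C' : Set V} (hC : C' ⊆ C) (hconn : (G.induce C').Connected)
    (hoff : ∀ i ≤ L, p i ∉ C') {i j k : ℕ} (hij : i < j) (hjk : j < k) (hk : k ≤ L)
    (hi' : ∃ u ∈ C', G.Adj u (p i)) (hj' : ∃ u ∈ C', G.Adj u (p j))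
    (hk' : ∃ u ∈ C', G.Adj u (p k)) : False := by
  obtain ⟨O, hO, h0, hL, hOC, o, ho, hoL⟩ := hp.linked.resolve_left (by omega)
  have hPO : ∀ l, 0 < l → l ≤ L → p l ∉ O := by
    intro l hl hl' hlO
    rcases hl'.eq_or_lt with rfl | hl'
    · exact hL hlO
    · exact Set.disjoint_left.1 hOC hlO (hp.inner l hl hl')
  have hC'P : ∀ m n, n ≤ L → Disjoint C' (p '' Set.Icc m n) := by
    intro m n hn
    rw [Set.disjoint_right]
    rintro _ ⟨l, hl, rfl⟩
    exact hoff l (hl.2.trans hn)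
  have hPP : ∀ m n m' n', n < m' → n' ≤ L →
      Disjoint (p '' Set.Icc m n) (p '' Set.Icc m' n') := by
    intro m n m' n' h h'
    rw [Set.disjoint_left]
    rintro _ ⟨l, hl, rfl⟩ ⟨l', hl', he⟩
    have h1 := hl.2
    have h2 := hl'.1
    have h3 := hl'.2
    have := hp.inj (by omega) (by omega) he
    omega
  have hOP : ∀ m n, 0 < m → n ≤ L → Disjoint O (p '' Set.Icc m n) := by
    intro m n hm hn
    rw [Set.disjoint_right]
    rintro _ ⟨l, hl, rfl⟩
    exact hPO l (hm.trans_le hl.1) (hl.2.trans hn)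
  have hseg : ∀ m n, m ≤ n → n ≤ L → (G.induce (p '' Set.Icc m n)).Connected :=
    fun m n h h' => connected_induce_image_Icc h fun l _ hl => hp.adj l (by omega)
  have hmem : ∀ {l m n}, m ≤ l → l ≤ n → p l ∈ p '' Set.Icc m n :=
    fun h1 h2 => ⟨_, ⟨h1, h2⟩, rfl⟩
  obtain ⟨u, hu, hui⟩ := hi'
  obtain ⟨v, hv, hvj⟩ := hj'
  obtain ⟨w, hw, hwk⟩ := hk'
  -- The path is cut after `i` and before `k`; `O` joins the first piece and supplies its edge to
  -- the last one, through `p L`.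
  refine hsp (isMinor_completeGraph_four (A := C') (B := O ∪ p '' Set.Icc 0 i)
    (C := p '' Set.Icc (i + 1) (k - 1)) (D := p '' Set.Icc k L) hconn ?_
    (hseg _ _ (by omega) (by omega)) (hseg _ _ hk le_rfl) ?_ (hC'P _ _ (by omega))
    (hC'P _ _ le_rfl) ?_ ?_ (hPP _ _ _ _ (by omega) le_rfl)
    ⟨u, hu, p i, Or.inr (hmem (by omega) le_rfl), hui⟩
    ⟨v, hv, p j, hmem (by omega) (by omega), hvj⟩
    ⟨w, hw, p k, hmem le_rfl hk, hwk⟩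
    ⟨p i, Or.inr (hmem (by omega) le_rfl), p (i + 1), hmem le_rfl (by omega),
      hp.adj i (by omega)⟩
    ⟨o, Or.inl ho, p L, hmem hk le_rfl, hoL⟩
    ⟨p (k - 1), hmem (by omega) le_rfl, p k, hmem le_rfl hk, ?_⟩)
  · exact SimpleGraph.induce_union_connected hO.preconnected
      (hseg 0 i (by omega) (by omega)).preconnected ⟨p 0, h0, hmem le_rfl (by omega)⟩
  · exact Set.disjoint_union_right.2 ⟨(hOC.mono_right hC).symm, hC'P _ _ (by omega)⟩
  · exact Set.disjoint_union_left.2 ⟨hOP _ _ (by omega) (by omega),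
      hPP _ _ _ _ (by omega) (by omega)⟩
  · exact Set.disjoint_union_left.2 ⟨hOP _ _ (by omega) le_rfl,
      hPP _ _ _ _ (by omega) le_rfl⟩
  · have := hp.adj (k - 1) (by omega)
    rwa [show k - 1 + 1 = k by omega] at this

/-- If the robber is off the path, then his territory shrinks to a smaller one, which is attached
to the path. -/
theorem IsShadowPath.exists_territory (hG : G.Connected) (hsp : IsSeriesParallel G)
    (hT : IsTerritory G X C a b) (hp : IsShadowPath G C a b p L f) {r : V} (hr : r ∈ C)
    (hoff : ∀ i ≤ L, p i ≠ r) :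
    ∃ C' ⊂ C, r ∈ C' ∧ ∃ i ≤ L, ∃ j ≤ L, IsTerritory G X C' (p i) (p j) := by
  classical
  obtain ⟨l, hl, hlC⟩ := hp.meets
  set S : Set V := {v | v ∈ C ∧ ∀ i ≤ L, p i ≠ v} with hS
  have hrS : r ∈ S := ⟨hr, hoff⟩
  have hsub : reachableWithin G S r ⊆ S := reachableWithin_subset S r
  have hconn := connected_reachableWithin (G := G) hrS
  set C' := reachableWithin G S r with hC'
  have hC'C : C' ⊆ C := fun v hv => (hsub hv).1
  have hC'P : ∀ i ≤ L, p i ∉ C' := fun i hi h => (hsub h).2 i hi rfl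
  have hbd : ∀ u ∈ C', ∀ v, G.Adj u v → v ∈ C' ∨ ∃ i ≤ L, p i = v := by
    intro u hu v huv
    by_cases hv : ∃ i ≤ L, p i = v
    · exact Or.inr hv
    rcases hT.boundary u (hC'C hu) v huv with h | rfl | rfl
    · exact Or.inl (mem_reachableWithin_of_adj hu huv ⟨h, fun i hi he => hv ⟨i, hi, he⟩⟩)
    · exact absurd hp.left hv
    · exact absurd hp.right hv
  -- The extreme indices of attachment become the new boundary; any index strictly between would be
  -- a third one.
  let I : Finset ℕ := (Finset.range (L + 1)).filter fun i => ∃ u ∈ C', G.Adj u (p i)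
  have hI : ∀ {i}, i ∈ I ↔ i ≤ L ∧ ∃ u ∈ C', G.Adj u (p i) := by
    intro i
    simp only [I, Finset.mem_filter, Finset.mem_range, Nat.lt_succ_iff]
  have hne : I.Nonempty := by
    obtain ⟨u, hu, v, hv, huv⟩ := exists_adj_reachableWithin hG hrS
      (fun h : p l ∈ S => h.2 l hl rfl)
    rcases hbd u hu v huv with h | ⟨i, hi, rfl⟩
    · exact absurd (hsub h) hv
    · exact ⟨i, hI.2 ⟨hi, u, hu, huv⟩⟩
  obtain ⟨hi, ui, hui, hai⟩ := hI.1 (I.min'_mem hne)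
  obtain ⟨hj, uj, huj, haj⟩ := hI.1 (I.max'_mem hne)
  have hmin : ∀ n ∈ I, I.min' hne ≤ n := fun n hn => I.min'_le n hn
  have hmax : ∀ n ∈ I, n ≤ I.max' hne := fun n hn => I.le_max' n hn
  generalize I.min' hne = i at *
  generalize I.max' hne = j at *
  refine ⟨C', ⟨hC'C, fun h => hC'P l hl (h hlC)⟩, mem_reachableWithin_self hrS, i, hi, j, hj,
    hconn, fun v hv => hT.notMem_exits v (hC'C hv), hC'P i hi, hC'P j hj,
    ⟨ui, hui, hai.symm⟩, ⟨uj, huj, haj.symm⟩, ?_, ?_⟩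
  · intro u hu v huv
    rcases hbd u hu v huv with h | ⟨n, hn, rfl⟩
    · exact Or.inl h
    · right
      have hnI : n ∈ I := hI.2 ⟨hn, u, hu, huv⟩
      rcases (hmin n hnI).eq_or_lt with rfl | h1
      · exact Or.inl rfl
      rcases (hmax n hnI).eq_or_lt with rfl | h2
      · exact Or.inr rfl
      exact (hp.attachments hsp hC'C hconn hC'P h1 h2 hj ⟨ui, hui, hai⟩ ⟨u, hu, huv⟩
        ⟨uj, huj, haj⟩).elim
  · rcases (hmin j (hI.2 ⟨hj, uj, huj, haj⟩)).eq_or_lt with rfl | hlt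
    · exact Or.inl rfl
    -- The path segment itself links the new boundary vertices outside `C'`.
    · refine Or.inr ⟨p '' Set.Icc i (j - 1),
        connected_induce_image_Icc (by omega) fun n _ hn => hp.adj n (by omega),
        ⟨i, ⟨le_rfl, by omega⟩, rfl⟩, ?_, ?_, p (j - 1), ⟨j - 1, ⟨by omega, le_rfl⟩, rfl⟩, ?_⟩
      · rintro ⟨n, hn, he⟩
        have h2 := hn.2
        have := hp.inj (by omega) hj he
        omega
      · rw [Set.disjoint_left]
        rintro _ ⟨n, hn, rfl⟩
        have h2 := hn.2
        exact hC'P n (by omega)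
      · have := hp.adj (j - 1) (by omega)
        rwa [show j - 1 + 1 = j by omega] at this

/-- If the boundary of the territory is a single vertex, then an edge from it into the territory
is a shadow path. -/
theorem IsTerritory.exists_shadowPath_of_eq (hT : IsTerritory G X C a a) :
    ∃ p L f, IsShadowPath G C a a p L f := by
  classical
  obtain ⟨y, hy, hay⟩ := hT.left_adj
  refine ⟨fun i => if i = 0 then a else y, 1, fun v => if v = a then 0 else 1, ?_, ?_, ?_, ?_,
    ?_, ⟨1, le_rfl, by simpa using hy⟩, ⟨0, by omega, rfl⟩, ⟨0, by omega, rfl⟩, Or.inl le_rfl⟩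
  · intro v; split_ifs <;> omega
  · intro i hi
    obtain rfl : i = 0 := by omega
    simpa using hay
  · intro i hi
    interval_cases i
    · simp
    · simp [hay.ne']
  · intro u _ v _
    split_ifs <;> omega
  · intro i h1 h2; omega

/-- If the boundary of the territory consists of two vertices, then a shortest path through the
territory is a shadow path. -/
theorem IsTerritory.exists_shadowPath_of_ne (hT : IsTerritory G X C a b) (hab : a ≠ b) :
    ∃ p L f, IsShadowPath G C a b p L f := by
  -- Discarding edges that miss `C`, in particular a possible edge `ab`, forces the geodesic through
  -- `C`.
  let H : SimpleGraph V :=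
    { Adj := fun u v => G.Adj u v ∧ (u ∈ C ∨ v ∈ C)
      symm := ⟨fun u v h => ⟨h.1.symm, h.2.symm⟩⟩
      loopless := ⟨fun u h => h.1.ne rfl⟩ }
  have hHmem : ∀ {u v}, H.Adj u v → u ∈ C ∨ u = a ∨ u = b := by
    rintro u v ⟨h, hu | hv⟩
    · exact Or.inl hu
    · exact hT.boundary v hv u h.symm
  have hreach : H.Reachable a b := by
    obtain ⟨u, hu, hau⟩ := hT.left_adj
    obtain ⟨v, hv, hbv⟩ := hT.right_adj
    have huv : H.Reachable u v :=
      (hT.conn.preconnected ⟨u, hu⟩ ⟨v, hv⟩).map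
        (⟨Subtype.val, fun {x y} h => ⟨h, Or.inl x.2⟩⟩ : G.induce C →g H)
    have h1 : H.Adj a u := ⟨hau, Or.inr hu⟩
    have h2 : H.Adj v b := ⟨hbv.symm, Or.inl hv⟩
    exact h1.reachable.trans (huv.trans h2.reachable)
  obtain ⟨w, hw⟩ := hreach.exists_walk_length_eq_dist
  have hadj : ∀ i < w.length, H.Adj (w.getVert i) (w.getVert (i + 1)) :=
    fun i hi => w.adj_getVert_succ hi
  have hdist : ∀ i ≤ w.length, H.dist a (w.getVert i) = i := by
    intro i hi
    have h1 : H.dist a (w.getVert i) ≤ i :=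
      (SimpleGraph.dist_le (w.take i)).trans (by simp)
    have h2 : H.dist (w.getVert i) b ≤ w.length - i :=
      (SimpleGraph.dist_le (w.drop i)).trans (by simp)
    have h3 := (w.take i).reachable.dist_triangle_left b
    omega
  have hinner : ∀ i, 0 < i → i < w.length → w.getVert i ∈ C := by
    intro i h1 h2
    have hd := hdist i h2.le
    rcases hHmem (hadj i h2) with h | h | h
    · exact h
    · rw [h, SimpleGraph.dist_self] at hd; omega
    · rw [h] at hd; omega
  have h0 : w.length ≠ 0 := fun h => hab (SimpleGraph.Walk.eq_of_length_eq_zero h)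
  have h1 : w.length ≠ 1 := by
    intro h
    obtain ⟨-, h | h⟩ := w.adj_of_length_eq_one h
    · exact hT.left_notMem h
    · exact hT.right_notMem h
  -- Vertices unreachable in `H` get the default distance 0; this is harmless, as no edge meeting
  -- `C` ends there.
  refine ⟨w.getVert, w.length, fun v => min (H.dist a v) w.length, fun v => min_le_right _ _,
    fun i hi => (hadj i hi).1, fun i hi => ?_, fun u hu v huv => ?_, hinner,
    ⟨1, by omega, hinner 1 (by omega) (by omega)⟩, ⟨0, by omega, w.getVert_zero⟩,
    ⟨w.length, le_rfl, w.getVert_length⟩, Or.inr ?_⟩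
  · rw [hdist i hi]
    omega
  · have hH : H.Adj u v := ⟨huv, Or.inl hu⟩
    have := hH.diff_dist_adj (u := a)
    omega
  · rw [w.getVert_zero, w.getVert_length]
    exact hT.linked.resolve_left hab

theorem IsTerritory.exists_shadowPath (hT : IsTerritory G X C a b) :
    ∃ p L f, IsShadowPath G C a b p L f := by
  by_cases hab : a = b
  · subst hab
    exact hT.exists_shadowPath_of_eq
  · exact hT.exists_shadowPath_of_ne hab

/-- Two cops, one of whom guards the territory of the robber, win. -/
theorem IsTerritory.wins [Finite V] (hG : G.Connected) (hsp : IsSeriesParallel G)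
    (hT : IsTerritory G X C a b) {g : V → V} (hg : IsGuardMap G C a b g) {i : Fin 2}
    {c : Fin 2 → V} {r : V} (hr : r ∈ C) (hi : Step G (c i) (g r)) : Wins G X c r := by
  induction hn : C.ncard using Nat.strong_induction_on generalizing C a b g i c r with
  | _ n ih =>
    obtain ⟨j, hij⟩ : ∃ j, i ≠ j := ⟨1 - i, by omega⟩
    obtain ⟨p, L, f, hp⟩ := hT.exists_shadowPath
    refine hT.wins_of_reposition hG hg hij (p 0) (fun c r hr hi hj => ?_) hr hi
    refine hT.wins_of_track hg hp hij (fun c r hr hj => ?_) hr hi (Nat.zero_le _) hj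
    by_cases hoff : ∃ l ≤ L, p l = r
    · obtain ⟨l, hl, rfl⟩ := hoff
      rw [hp.apply_path l hl] at hj
      exact Wins.of_catch j hj
    · push Not at hoff
      obtain ⟨C', hC', hrC', l, hl, m, hm, hT'⟩ := hp.exists_territory hG hsp hT hr hoff
      -- Cop `j`, next to the shadow, is the new guard, and cop `i` is freed.
      exact ih _ (hn ▸ Set.ncard_lt_ncard hC') hT' (hp.isGuardMap hC'.1 hl hm) hrC' hj rfl

end Territory

/-! ### From one exit to the theorem -/

theorem wins_of_cop_at_exit {V : Type*} [Finite V] {G : SimpleGraph V} (hG : G.Connected)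
    (hsp : IsSeriesParallel G) {x : V} {c : Fin 2 → V} {i : Fin 2} (hi : c i = x) (r : V) :
    Wins G {x} c r := by
  by_cases hrx : r = x
  · exact Wins.of_catch i (Or.inl (hi.trans hrx.symm))
  have hrS : r ∈ ({x}ᶜ : Set V) := hrx
  have hsub := reachableWithin_subset (G := G) {x}ᶜ r
  obtain ⟨u, hu, v, hv, huv⟩ := exists_adj_reachableWithin hG hrS (fun h : x ∈ ({x}ᶜ : Set V) => h rfl)
  obtain rfl : v = x := not_not.1 hv
  have hT : IsTerritory G {v} (reachableWithin G {v}ᶜ r) v v :=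
    { conn := connected_reachableWithin hrS
      notMem_exits := fun z hz h => hsub hz (Finset.mem_singleton.1 h)
      left_notMem := fun h => hsub h rfl
      right_notMem := fun h => hsub h rfl
      left_adj := ⟨u, hu, huv.symm⟩
      right_adj := ⟨u, hu, huv.symm⟩
      boundary := fun y hy z hyz => by
        by_cases hz : z = v
        · exact Or.inr (Or.inl hz)
        · exact Or.inl (mem_reachableWithin_of_adj hy hyz hz)
      linked := Or.inl rfl }
  -- A cop staying on the only boundary vertex is a guard with constant shadow.
  exact hT.wins hG hsp (g := fun _ => v) ⟨rfl, rfl, fun _ _ _ _ => Or.inl rfl⟩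
    (mem_reachableWithin_self hrS) (Or.inl hi)

theorem exitCopwin_singleton {V : Type*} [Finite V] {G : SimpleGraph V} (hG : G.Connected)
    (hsp : IsSeriesParallel G) (x : V) : ExitCopwin G {x} 2 := by
  obtain ⟨σ, hσ⟩ := exists_strategy_copsWin G {x} 2
  refine ⟨by simp, σ, fun p h0 hp => hσ p ?_ hp⟩
  obtain ⟨i, hi⟩ := h0 x (Finset.mem_singleton_self x)
  exact wins_of_cop_at_exit hG hsp hi _

theorem ExitCopwin.copwin {V : Type*} {G : SimpleGraph V} {k : ℕ} [NeZero k] {x : V}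
    (h : ExitCopwin G {x} k) : Copwin G k := by
  obtain ⟨-, σ, hσ⟩ := h
  refine ⟨fun _ => x, σ, fun p h0 hp => ?_⟩
  obtain ⟨t, ht, -⟩ := hσ p (fun y hy => ⟨0, by rw [h0, Finset.mem_singleton.1 hy]⟩) hp
  exact ⟨t, ht, fun s _ he => Finset.notMem_empty _ he.1⟩

end CopsRobber

theorem theorem1 {V : Type*} [Finite V] (G : SimpleGraph V) (hconn : G.Connected)
    (hsp : CopsRobber.IsSeriesParallel G) :
    (∀ x : V, CopsRobber.ExitCopwin G {x} 2) ∧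
      CopsRobber.Copwin G 2 ∧ CopsRobber.copNumber G ≤ 2 := by
  have hexit := CopsRobber.exitCopwin_singleton hconn hsp
  obtain ⟨x⟩ := hconn.nonempty
  have hwin : CopsRobber.Copwin G 2 := (hexit x).copwin
  exact ⟨hexit, hwin, Nat.sInf_le ⟨one_le_two, hwin⟩⟩
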